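/- Let $G$ be a finite $2$-group. For a subgroup $H \le G$ let $\mathrm{sbr}(H)$ be the integer with $[G:N_G(H)] = 2^{\mathrm{sbr}(H)}$, and let the subgroup breadth $\mathrm{sbr}(G)$ be the maximum of $\mathrm{sbr}(H)$ over all subgroups $H$ of $G$. If $\mathrm{sbr}(G) = 1$ and $G$ contains two involutions (elements of order $2$) that do not commute, then the center of $G$ has index at most $16$, i.e. $[G:Z(G)] \le 16$. -/

import Mathlib

/-- The subgroup breadth `sbr(H)` of a subgroup `H` of a finite `p`-group `G`: the integer with
`[G : N_G(H)] = p ^ sbr(H)` (see `index_normalizer_eq_pow_sbr`). -/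
noncomputable def sbr {G : Type*} [Group G] (p : ℕ) (H : Subgroup G) : ℕ :=
  Nat.log p (Subgroup.normalizer (H : Set G)).index

/-- The defining property of the breadth of a subgroup of a finite `p`-group. -/
theorem index_normalizer_eq_pow_sbr {G : Type*} [Group G] [Finite G] {p : ℕ} [hp : Fact p.Prime]
    (hG : IsPGroup p G) (H : Subgroup G) :
    (Subgroup.normalizer (H : Set G)).index = p ^ sbr p H := by
  obtain ⟨n, hn⟩ := hG.index (Subgroup.normalizer (H : Set G))
  rw [sbr, hn, Nat.log_pow hp.out.one_lt]

/-- The subgroup breadth `sbr(G)` of a finite `p`-group `G`: the maximum of `sbr(H)` over all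
subgroups `H` of `G` (see `isGreatest_groupSbr`). -/
noncomputable def groupSbr (p : ℕ) (G : Type*) [Group G] : ℕ :=
  ⨆ H : Subgroup G, sbr p H

/-- For a finite group, the supremum defining the subgroup breadth is attained. -/
theorem isGreatest_groupSbr (p : ℕ) (G : Type*) [Group G] [Finite G] :
    IsGreatest (Set.range fun H : Subgroup G => sbr p H) (groupSbr p G) := by
  have hb : BddAbove (Set.range fun H : Subgroup G => sbr p H) := (Set.finite_range _).bddAbove
  exact ⟨Nat.sSup_mem (Set.range_nonempty _) hb, fun _ h => le_csSup hb h⟩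

/-! ### Powers, involutions and commutators in a 2-group -/

section TwoGroup

variable {C : Type*} [Group C]

/-! Breadth one makes every normalizer of index at most 2; in particular involutions have
centralizers of index at most 2. So two noncommuting involutions `s`, `t` generate a dihedral group
of order 8 with center generated by `z = (s * t) ^ 2`, and every `g` lies in `C * ⟨s, t⟩`, where `C`
is the centralizer of `{s, t}`. Four coset representatives reduce `G` to `C`, and the center of `C`
is central in `G`. It remains to see that the center of `C` has index at most 4 in `C`.

For this, every cyclic subgroup of `C` is shown to be normal. Testing the normalizer condition on
`⟨s, x⟩` and on the involution `s * t * x` yields `NearDedekind`: only the `x` with `z ∈ ⟨x⟩` remain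
in doubt. Say that `x` has depth `N` if `x ^ 2 ^ N = z`. Depths 0 and 1 are immediate, and elements
of depth at least 2 turn out to be central (`conj_mem_zpowers`). Finally, a 2-group with all cyclic
subgroups normal is abelian or is a quaternion group times its center, which gives the factor 4. -/

theorem zpow_eq_one_or_self {u : C} (hu : u ^ 2 = 1) (k : ℤ) : u ^ k = 1 ∨ u ^ k = u := by
  have h2 : u ^ (2 : ℤ) = 1 := by exact_mod_cast hu
  obtain ⟨m, rfl | rfl⟩ := Int.even_or_odd' k
  · left; rw [zpow_mul, h2, one_zpow]
  · right; rw [zpow_add, zpow_mul, h2, one_zpow, one_mul, zpow_one]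

/-- A cyclic `2`-group has at most one involution. -/
theorem involution_eq_of_mem_zpowers {h u w : C} {k : ℕ} (hk : h ^ 2 ^ k = u) (hu1 : u ≠ 1)
    (hu : u ^ 2 = 1) {j : ℤ} (hj : h ^ j = w) (hw1 : w ≠ 1) (hw : w ^ 2 = 1) : w = u := by
  have ho : orderOf h = 2 ^ (k + 1) := by
    apply orderOf_eq_prime_pow
    · rwa [hk]
    · rw [pow_succ, pow_mul, hk, hu]
  have h1 : h ^ (j * 2) = 1 := by
    rw [zpow_mul, hj]; exact_mod_cast hw
  have h2 : ((2 ^ (k + 1) : ℕ) : ℤ) ∣ j * 2 := by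
    rw [← ho]; exact orderOf_dvd_iff_zpow_eq_one.2 h1
  have h3 : (2 ^ k : ℤ) ∣ j := by
    rw [Nat.cast_pow, pow_succ] at h2
    exact Int.dvd_of_mul_dvd_mul_right (by norm_num) h2
  obtain ⟨q, rfl⟩ := h3
  have h4 : w = u ^ q := by
    rw [← hj, zpow_mul, ← hk]; norm_cast
  rcases zpow_eq_one_or_self hu q with h5 | h5
  · exact absurd (h4.trans h5) hw1
  · exact h4.trans h5

theorem exists_pow_two_pow_involution (hC : IsPGroup 2 C) {g : C} (hg : g ≠ 1) :
    ∃ M : ℕ, g ^ 2 ^ M ≠ 1 ∧ (g ^ 2 ^ M) ^ 2 = 1 := by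
  classical
  have hex := hC g
  have hpos : Nat.find hex ≠ 0 := fun h0 => hg (by simpa [h0] using Nat.find_spec hex)
  obtain ⟨M, hM⟩ := Nat.exists_eq_succ_of_ne_zero hpos
  refine ⟨M, Nat.find_min hex (by omega), ?_⟩
  rw [← pow_mul, ← pow_succ]
  have := Nat.find_spec hex
  rwa [hM] at this

theorem zpow_ne_or_exists_pow_eq (hC : IsPGroup 2 C) {z : C} (hz1 : z ≠ 1) (hz2 : z ^ 2 = 1)
    (g : C) : (∀ k : ℤ, g ^ k ≠ z) ∨ ∃ M : ℕ, g ^ 2 ^ M = z := by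
  by_cases hg : g = 1
  · left; intro k; rw [hg, one_zpow]; exact hz1.symm
  by_cases h : ∀ k : ℤ, g ^ k ≠ z
  · exact Or.inl h
  push Not at h
  obtain ⟨k, hk⟩ := h
  obtain ⟨M, h1, h2⟩ := exists_pow_two_pow_involution hC hg
  exact Or.inr ⟨M, (involution_eq_of_mem_zpowers rfl h1 h2 hk hz1 hz2).symm⟩

theorem pow_mul_eq_of_mul_eq {x g v : C} (h : x * g = g * x * v) (hv : Commute v x) (i : ℕ) :
    x ^ i * g = g * x ^ i * v ^ i := by
  induction i with
  | zero => simp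
  | succ i ih =>
    calc x ^ (i + 1) * g = x ^ i * (x * g) := by rw [pow_succ, mul_assoc]
      _ = x ^ i * g * (x * v) := by rw [h]; simp only [mul_assoc]
      _ = g * x ^ i * (v ^ i * x) * v := by rw [ih]; simp only [mul_assoc]
      _ = g * x ^ i * (x * v ^ i) * v := by rw [(hv.pow_left i).eq]
      _ = g * x ^ (i + 1) * v ^ (i + 1) := by rw [pow_succ, pow_succ]; simp only [mul_assoc]

/-- Since `(q * g) ^ 2 = q ^ 2 * g ^ 2 * u`, the commutator survives one squaring and dies at the
second; hence `2 ≤ k` unless `u = 1`. -/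
theorem mul_pow_two_pow {q g u : C} (h : q * g = g * q * u) (huq : Commute u q)
    (hug : Commute u g) (hu : u ^ 2 = 1) {k : ℕ} (hk : 2 ≤ k ∨ u = 1) :
    (q * g) ^ 2 ^ k = q ^ 2 ^ k * g ^ 2 ^ k := by
  by_cases hu1 : u = 1
  · subst hu1
    exact (show Commute q g by simpa [Commute, SemiconjBy] using h).mul_pow _
  have hk2 : 2 ≤ k := hk.resolve_right hu1
  have hq2 : Commute (q ^ 2) g := by
    have := pow_mul_eq_of_mul_eq h huq 2
    rwa [hu, mul_one] at this
  have h2 : (q * g) ^ 2 = q ^ 2 * g ^ 2 * u := by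
    have h' : g * q = q * g * u := by
      rw [h, mul_assoc, ← sq, hu, mul_one]
    calc (q * g) ^ 2 = q * (g * q) * g := by rw [sq]; simp only [mul_assoc]
      _ = q * q * g * (u * g) := by rw [h']; simp only [mul_assoc]
      _ = q ^ 2 * g ^ 2 * u := by rw [hug.eq, sq, sq]; simp only [mul_assoc]
  have h4 : (q * g) ^ 4 = (q ^ 2) ^ 2 * (g ^ 2) ^ 2 := by
    have hc : Commute (q ^ 2 * g ^ 2) u := ((huq.pow_right 2).mul_right (hug.pow_right 2)).symm
    rw [show (4 : ℕ) = 2 * 2 from rfl, pow_mul, h2, hc.mul_pow, hu, mul_one,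
      (hq2.pow_right 2).mul_pow]
  obtain ⟨j, rfl⟩ := Nat.exists_eq_add_of_le hk2
  have h5 : Commute ((q ^ 2) ^ 2) ((g ^ 2) ^ 2) := ((hq2.pow_right 2).pow_right 2).pow_left 2
  rw [pow_add, show (2 ^ 2 : ℕ) = 4 from rfl, pow_mul, h4, h5.mul_pow]
  simp only [← pow_mul]

theorem commute_of_commute_pow_mul {x g : C} (i : ℕ) (h : Commute x (x ^ i * g)) :
    Commute x g := by
  have h1 : Commute x ((x ^ i)⁻¹ * (x ^ i * g)) :=
    ((Commute.refl x).pow_right i).inv_right.mul_right h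
  rwa [inv_mul_cancel_left] at h1

theorem commute_of_conj_mem_zpowers_of_sq_eq_one
    {u : C} (h : ∀ y : C, ∃ k : ℤ, y * u * y⁻¹ = u ^ k) (hu : u ^ 2 = 1) (y : C) :
    Commute u y := by
  by_cases hu1 : u = 1
  · rw [hu1]; exact Commute.one_left y
  obtain ⟨k, hk⟩ := h y
  rcases zpow_eq_one_or_self hu k with h1 | h1
  · rw [h1] at hk
    exact absurd (by simpa using hk) hu1
  · rw [h1] at hk
    exact (mul_inv_eq_iff_eq_mul.1 hk).symm

/-! ### Groups in which the cyclic subgroups avoiding a central involution are normal -/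

/-- The cyclic subgroups of `C` avoiding the central involution `z` are normal, the square roots
of `z` are centralized modulo `z`, and squares normalize every cyclic subgroup. -/
structure NearDedekind (z : C) : Prop where
  ne_one : z ≠ 1
  sq_eq_one : z ^ 2 = 1
  central : ∀ y : C, Commute z y
  conj_of_avoid : ∀ x : C, (∀ k : ℤ, x ^ k ≠ z) → ∀ y, ∃ k : ℤ, y * x * y⁻¹ = x ^ k
  conj_of_sq_eq : ∀ x : C, x ^ 2 = z → ∀ y, y * x * y⁻¹ = x ∨ y * x * y⁻¹ = x * z
  conj_sq : ∀ x y : C, ∃ k : ℤ, y ^ 2 * x * (y ^ 2)⁻¹ = x ^ k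

namespace NearDedekind

variable {z : C}

theorem commute_of_sq_eq_one (hz : NearDedekind z) {u : C} (hu : u ^ 2 = 1) (y : C) :
    Commute u y := by
  by_cases huz : u = z
  · rw [huz]; exact hz.central y
  by_cases hu1 : u = 1
  · rw [hu1]; exact Commute.one_left y
  refine commute_of_conj_mem_zpowers_of_sq_eq_one (hz.conj_of_avoid u fun k hk => ?_) hu y
  rcases zpow_eq_one_or_self hu k with h | h
  · exact hz.ne_one (hk.symm.trans h)
  · exact huz (h.symm.trans hk)

/-- A cyclic subgroup with involution `z * w` is normalized, hence meets `⟨w⟩` nontrivially if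
some element multiplies its generator by `w`. -/
theorem conj_ne_mul (hz : NearDedekind z) {h w : C} {k : ℕ} (hk : h ^ 2 ^ k = z * w)
    (hw1 : w ≠ 1) (hw : w ^ 2 = 1) (hwz : w ≠ z) (y : C) : y * h * y⁻¹ ≠ h * w := by
  intro hy
  have hzw1 : z * w ≠ 1 := by
    intro h1
    apply hwz
    have h2 : z * w = z * z := by rw [h1, ← sq, hz.sq_eq_one]
    exact mul_left_cancel h2
  have hzw : (z * w) ^ 2 = 1 := by
    rw [(hz.central w).mul_pow, hz.sq_eq_one, hw, one_mul]
  obtain ⟨j, hj⟩ := hz.conj_of_avoid h (fun j hj => by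
    have := involution_eq_of_mem_zpowers hk hzw1 hzw hj hz.ne_one hz.sq_eq_one
    exact hw1 (by simpa using this.symm)) y
  have h3 : h ^ (j - 1) = w := by
    rw [sub_eq_neg_add, zpow_add, ← hj, hy]; simp
  have := involution_eq_of_mem_zpowers hk hzw1 hzw h3 hw1 hw
  exact hz.ne_one (by simpa using this.symm)

/-- By induction `x` commutes with `g ^ 2`, so a nontrivial commutator is the involution `w` of
`⟨g⟩`. A product of suitable powers of `x` and `g` then has `z * w` as a 2-power and is multiplied
by `w` under conjugation, contrary to `conj_ne_mul`. -/
theorem commute_of_avoid (hz : NearDedekind z) {x : C} {N : ℕ} (hN : 2 ≤ N)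
    (hx : x ^ 2 ^ N = z) {w : C} (hw1 : w ≠ 1) (hw : w ^ 2 = 1) (M : ℕ) :
    ∀ g : C, g ^ 2 ^ M = w → (∀ k : ℤ, g ^ k ≠ z) → Commute x g := by
  have hwc := hz.commute_of_sq_eq_one hw
  induction M with
  | zero =>
    intro g hg _
    have : g = w := by simpa using hg
    rw [this]; exact (hwc x).symm
  | succ M ih =>
    intro g hg hgz
    have hwz : w ≠ z := fun h => hgz ((2 ^ (M + 1) : ℕ)) (by rw [zpow_natCast, hg, h])
    have hg2 : Commute x (g ^ 2) := by
      apply ih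
      · rw [← pow_mul, ← pow_succ', hg]
      · intro k hk
        apply hgz (2 * k)
        rw [zpow_mul]; exact_mod_cast hk
    obtain ⟨k, hk⟩ := hz.conj_of_avoid g hgz x
    by_contra hxg
    set v := g ^ (k - 1) with hv
    have hvg : Commute v g := (Commute.refl g).zpow_left _
    have hgv : x * g * x⁻¹ = g * v := by
      rw [hk, hv, ← zpow_one_add]; congr 1; ring
    have hv1 : v ≠ 1 := fun h => by
      rw [h, mul_one] at hgv
      exact hxg (mul_inv_eq_iff_eq_mul.1 hgv)
    have hv2 : v ^ 2 = 1 := by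
      have h1 : (x * g * x⁻¹) ^ 2 = g ^ 2 := by
        rw [conj_pow]; exact mul_inv_eq_iff_eq_mul.2 hg2.eq
      rw [hgv, hvg.symm.mul_pow] at h1
      simpa using h1
    have hvw : v = w := involution_eq_of_mem_zpowers hg hw1 hw hv.symm hv1 hv2
    rw [hvw] at hgv
    have hxgw : x * g = g * x * w := by
      rw [mul_inv_eq_iff_eq_mul.1 hgv, mul_assoc, mul_assoc, (hwc x).eq]
    have hgxw : g * x = x * g * w := by
      rw [hxgw, mul_assoc, ← sq, hw, mul_one]
    have even_pow (i : ℕ) (hi : Even i) : w ^ i = 1 := by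
      obtain ⟨j, rfl⟩ := hi.two_dvd
      rw [pow_mul, hw, one_pow]
    have sq_pow (i : ℕ) : (w ^ i) ^ 2 = 1 := by rw [← pow_mul, mul_comm, pow_mul, hw, one_pow]
    rcases le_or_gt (M + 1) N with hMN | hMN
    -- The exponent makes `x ^ i` of depth `M + 1`, so that the `2 ^ (M + 1)`-th powers of `x ^ i`
    -- and `g` are `z` and `w`.
    · set i := 2 ^ (N - (M + 1)) with hi
      have hp := mul_pow_two_pow (k := M + 1) (pow_mul_eq_of_mul_eq hxgw (hwc x) i)
        ((hwc _).pow_left i) ((hwc _).pow_left i) (sq_pow i) (by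
          -- For `M = 0` there is a single squaring, but `i = 2 ^ (N - 1)` is even because `2 ≤ N`,
          -- so `w ^ i = 1`.
          rcases Nat.eq_zero_or_pos M with rfl | hM
          · right
            apply even_pow
            exact Nat.even_pow.2 ⟨even_two, by omega⟩
          · left; omega)
      have hq : (x ^ i * g) ^ 2 ^ (M + 1) = z * w := by
        rw [hp, hg, hi, ← pow_mul, ← pow_add, Nat.sub_add_cancel hMN, hx]
      refine hz.conj_ne_mul hq hw1 hw hwz x ?_
      calc x * (x ^ i * g) * x⁻¹ = x ^ i * (x * g * x⁻¹) := by
            rw [← mul_assoc, ← pow_succ', pow_succ]; simp only [mul_assoc]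
        _ = x ^ i * g * w := by rw [hgv, mul_assoc]
    · set i := 2 ^ (M + 1 - N) with hi
      have hp := mul_pow_two_pow (k := N) (pow_mul_eq_of_mul_eq hgxw (hwc g) i)
        ((hwc _).pow_left i) ((hwc _).pow_left i) (sq_pow i) (Or.inl hN)
      have hq : (g ^ i * x) ^ 2 ^ N = z * w := by
        rw [hp, hx, hi, ← pow_mul, ← pow_add, Nat.sub_add_cancel hMN.le, hg, (hwc z).eq]
      refine hz.conj_ne_mul hq hw1 hw hwz g ?_
      calc g * (g ^ i * x) * g⁻¹ = g ^ i * (g * x * g⁻¹) := by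
            rw [← mul_assoc, ← pow_succ', pow_succ]; simp only [mul_assoc]
        _ = g ^ i * x * w := by
            rw [hgxw, mul_assoc (x * g), (hwc g⁻¹).eq]; simp only [mul_assoc, mul_inv_cancel_left]

/-- If the commutator is `z`, then the even power `x ^ 2 ^ (N - 1)` still commutes with `g`. Both
square to `z`, so their product squares to 1 and is central. -/
theorem commute_of_sq_eq (hz : NearDedekind z) {x g : C} {N : ℕ} (hN : 2 ≤ N)
    (hx : x ^ 2 ^ N = z) (hg : g ^ 2 = z) : Commute x g := by
  rcases hz.conj_of_sq_eq g hg x with h | h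
  · exact mul_inv_eq_iff_eq_mul.1 h
  have hxg : x * g = g * x * z := by
    rw [mul_inv_eq_iff_eq_mul.1 h, mul_assoc, mul_assoc, (hz.central x).eq]
  apply commute_of_commute_pow_mul (2 ^ (N - 1))
  apply (hz.commute_of_sq_eq_one _ x).symm
  have h1 := pow_mul_eq_of_mul_eq hxg (hz.central x) (2 ^ (N - 1))
  have h2 : z ^ 2 ^ (N - 1) = 1 := by
    rw [show N - 1 = 1 + (N - 2) by omega, pow_add, pow_mul, pow_one, hz.sq_eq_one, one_pow]
  rw [h2, mul_one] at h1
  rw [(show Commute _ _ from h1).mul_pow, ← pow_mul, ← pow_succ, Nat.sub_add_cancel (by omega),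
    hx, hg, ← sq, hz.sq_eq_one]

/-- Inductive step on the sum of depths: once the commutator is known to be a central involution,
`g` can be replaced by some `x ^ i * g` that avoids `z` or has smaller depth. -/
theorem commute_of_pow_eq_aux (hC : IsPGroup 2 C) (hz : NearDedekind z) {N M : ℕ} (hM : 2 ≤ M)
    (hMN : M ≤ N) (ih : ∀ N' M' : ℕ, 2 ≤ N' → 2 ≤ M' → N' + M' < N + M →
      ∀ x g : C, x ^ 2 ^ N' = z → g ^ 2 ^ M' = z → Commute x g)
    {x g : C} (hx : x ^ 2 ^ N = z) (hg : g ^ 2 ^ M = z) : Commute x g := by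
  have hN : 2 ≤ N := hM.trans hMN
  have small (y : C) (hy : (∀ k : ℤ, y ^ k ≠ z) ∨ ∃ j, j < M ∧ y ^ 2 ^ j = z) : Commute x y := by
    rcases hy with hy | ⟨j, hj, hy⟩
    · by_cases hy1 : y = 1
      · rw [hy1]; exact Commute.one_right x
      obtain ⟨K, h1, h2⟩ := exists_pow_two_pow_involution hC hy1
      exact hz.commute_of_avoid hN hx h1 h2 K y rfl hy
    · match j, hy with
      | 0, hy =>
        have : y = z := by simpa using hy
        rw [this]; exact (hz.central x).symm
      | 1, hy => exact hz.commute_of_sq_eq hN hx (by simpa using hy)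
      | j + 2, hy => exact ih N (j + 2) hN (by omega) (by omega) x y hx hy
  have hg2 : Commute x (g ^ 2) := by
    refine small _ (Or.inr ⟨M - 1, by omega, ?_⟩)
    rw [← pow_mul, ← pow_succ', Nat.sub_add_cancel (by omega), hg]
  have hx2 : Commute (x ^ 2) g := by
    rcases hN.eq_or_lt with rfl | hN
    · refine (hz.commute_of_sq_eq hM hg ?_).symm
      rw [← pow_mul, ← hx]; rfl
    · refine ih (N - 1) M (by omega) hM (by omega) _ _ ?_ hg
      rw [← pow_mul, ← pow_succ', Nat.sub_add_cancel (by omega), hx]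
  by_contra hxg
  obtain ⟨v, hv⟩ : ∃ v, x * v = g⁻¹ * x * g := ⟨x⁻¹ * (g⁻¹ * x * g), by group⟩
  have hxgv : x * g = g * x * v := by rw [mul_assoc, hv]; group
  have hxv2 : (x * v) ^ 2 = x ^ 2 := by
    rw [hv]
    have := conj_pow (i := 2) (a := g⁻¹) (b := x)
    rw [inv_inv] at this
    rw [this, mul_assoc, hx2.eq, inv_mul_cancel_left]
  have hvx : v * x = x * v⁻¹ := by
    have h1 : x * (v * (x * v)) = x * x := by rw [← sq x, ← hxv2, sq]; simp only [mul_assoc]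
    rw [eq_mul_inv_iff_mul_eq, mul_assoc]; exact mul_left_cancel h1
  have hgv : v * g = g * v⁻¹ := by
    have h1 : x * (g * g) = g * (g * (x * v * v⁻¹)) := by
      rw [mul_inv_cancel_right, ← sq, hg2.eq, sq, mul_assoc]
    have h2 : x * (g * g) = g * (g * (x * v)) * (g⁻¹ * v * g) := by
      calc x * (g * g) = g * x * v * g := by rw [← mul_assoc, hxgv]
        _ = g * (x * g) * (g⁻¹ * v * g) := by group
        _ = g * (g * (x * v)) * (g⁻¹ * v * g) := by rw [hxgv, mul_assoc g x v]
    rw [h1, mul_inv_cancel_right] at h2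
    have h3 : v * (g⁻¹ * v * g) = 1 := by
      have : g * (g * x) * 1 = g * (g * x) * (v * (g⁻¹ * v * g)) := by
        rw [mul_one]
        simpa only [mul_assoc] using h2
      exact (mul_left_cancel this).symm
    have h4 : g⁻¹ * v * g = v⁻¹ := eq_inv_of_mul_eq_one_right h3
    rw [← h4]; group
  have hvinv : v ^ 2 = 1 := by
    have key : Commute x v := by
      -- As `x * g` centralizes `v`, conjugating `x` twice by its inverse gives `x * v ^ 2`, which
      -- lies in `⟨x⟩` by `conj_sq`.
      have hv2x : Commute x (v ^ 2) := by
        obtain ⟨k, hk⟩ := hz.conj_sq x (x * g)⁻¹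
        have h1 : (x * g)⁻¹ * x * (x * g) = x * v := by rw [hv]; group
        have h2 : Commute v (x * g) := by
          show v * (x * g) = x * g * v
          have h : v⁻¹ * g = g * v := by
            rw [inv_mul_eq_iff_eq_mul, ← mul_assoc, hgv, inv_mul_cancel_right]
          rw [← mul_assoc, hvx, mul_assoc, mul_assoc, h]
        have h3 : x ^ k = x * v ^ 2 := by
          calc x ^ k = (x * g)⁻¹ * ((x * g)⁻¹ * x * (x * g)) * (x * g) := by
                rw [← hk]; simp only [sq, mul_inv_rev, inv_inv, mul_assoc]
            _ = (x * g)⁻¹ * x * (v * (x * g)) := by rw [h1]; simp only [mul_assoc]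
            _ = ((x * g)⁻¹ * x * (x * g)) * v := by rw [h2.eq]; simp only [mul_assoc]
            _ = x * v ^ 2 := by rw [h1, sq, mul_assoc]
        rw [eq_inv_mul_iff_mul_eq.2 h3.symm]
        exact (Commute.refl x).inv_right.mul_right ((Commute.refl x).zpow_right k)
      have hv4 : v ^ 4 = 1 := by
        have h1 : v ^ 2 * x = x * (v ^ 2)⁻¹ := by
          rw [sq, mul_assoc, hvx, ← mul_assoc, hvx, mul_assoc]; group
        have h2 : v ^ 2 = (v ^ 2)⁻¹ := mul_left_cancel (hv2x.eq.trans h1)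
        rw [show (4 : ℕ) = 2 + 2 from rfl, pow_add]
        nth_rewrite 2 [h2]
        exact mul_inv_cancel _
      rcases zpow_ne_or_exists_pow_eq hC hz.ne_one hz.sq_eq_one v with h | ⟨j, hj⟩
      · exact small v (Or.inl h)
      · refine small v (Or.inr ⟨j, ?_, hj⟩)
        by_contra hjM
        apply hz.ne_one
        obtain ⟨i, rfl⟩ := Nat.exists_eq_add_of_le (show 2 ≤ j by omega)
        rw [← hj, pow_add, pow_mul, show (2 ^ 2 : ℕ) = 4 from rfl, hv4, one_pow]
    have h1 : v = v⁻¹ := mul_left_cancel (key.eq.trans hvx)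
    rw [sq]; nth_rewrite 2 [h1]; exact mul_inv_cancel v
  have hvc := hz.commute_of_sq_eq_one hvinv
  set i := 2 ^ (N - M) with hi
  have hp := mul_pow_two_pow (k := M) (pow_mul_eq_of_mul_eq hxgv (hvc x) i)
    ((hvc _).pow_left i) ((hvc _).pow_left i)
    (by rw [← pow_mul, mul_comm, pow_mul, hvinv, one_pow]) (Or.inl hM)
  have hq : (x ^ i * g) ^ 2 ^ M = 1 := by
    rw [hp, hg, hi, ← pow_mul, ← pow_add, Nat.sub_add_cancel hMN, hx, ← sq, hz.sq_eq_one]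
  refine hxg (commute_of_commute_pow_mul i (small _ ?_))
  rcases zpow_ne_or_exists_pow_eq hC hz.ne_one hz.sq_eq_one (x ^ i * g) with h | ⟨j, hj⟩
  · exact Or.inl h
  · refine Or.inr ⟨j, ?_, hj⟩
    by_contra hjM
    apply hz.ne_one
    rw [← hj, ← Nat.sub_add_cancel (not_lt.1 hjM), add_comm, pow_add, pow_mul, hq, one_pow]

theorem commute_of_pow_eq (hC : IsPGroup 2 C) (hz : NearDedekind z) (s : ℕ) :
    ∀ N M : ℕ, 2 ≤ N → 2 ≤ M → N + M = s →
      ∀ x g : C, x ^ 2 ^ N = z → g ^ 2 ^ M = z → Commute x g := by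
  induction s using Nat.strong_induction_on with
  | _ s ih =>
    rintro N M hN hM rfl x g hx hg
    have ih' : ∀ N' M' : ℕ, 2 ≤ N' → 2 ≤ M' → N' + M' < N + M →
        ∀ x g : C, x ^ 2 ^ N' = z → g ^ 2 ^ M' = z → Commute x g :=
      fun N' M' h1 h2 h3 => ih _ h3 N' M' h1 h2 rfl
    rcases le_total M N with h | h
    · exact commute_of_pow_eq_aux hC hz hM h ih' hx hg
    · exact (commute_of_pow_eq_aux hC hz hN h (by simpa only [add_comm M N] using ih') hg hx).symm

/-- Every cyclic subgroup of `C` is normal. -/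
theorem conj_mem_zpowers (hC : IsPGroup 2 C) (hz : NearDedekind z) (x y : C) :
    ∃ k : ℤ, y * x * y⁻¹ = x ^ k := by
  rcases zpow_ne_or_exists_pow_eq hC hz.ne_one hz.sq_eq_one x with h | ⟨N, hN⟩
  · exact hz.conj_of_avoid x h y
  have of_comm (h : Commute x y) : ∃ k : ℤ, y * x * y⁻¹ = x ^ k :=
    ⟨1, by rw [zpow_one]; exact mul_inv_eq_iff_eq_mul.2 h.eq.symm⟩
  match N, hN with
  | 0, hN =>
    have : x = z := by simpa using hN
    exact of_comm (this ▸ hz.central y)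
  | 1, hN =>
    have hN : x ^ 2 = z := by simpa using hN
    rcases hz.conj_of_sq_eq x hN y with h | h
    · exact ⟨1, by rw [h, zpow_one]⟩
    · exact ⟨3, by rw [h, ← hN, ← pow_succ']; norm_cast⟩
  -- Elements of depth at least 2 commute with every `y`, whatever the position of `y` relative to
  -- `z`.
  | N + 2, hN =>
    apply of_comm
    rcases zpow_ne_or_exists_pow_eq hC hz.ne_one hz.sq_eq_one y with h | ⟨M, hM⟩
    · by_cases hy1 : y = 1
      · rw [hy1]; exact Commute.one_right x
      obtain ⟨K, h1, h2⟩ := exists_pow_two_pow_involution hC hy1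
      exact hz.commute_of_avoid (by omega) hN h1 h2 K y rfl h
    · match M, hM with
      | 0, hM =>
        have : y = z := by simpa using hM
        rw [this]; exact (hz.central x).symm
      | 1, hM => exact hz.commute_of_sq_eq (by omega) hN (by simpa using hM)
      | M + 2, hM => exact commute_of_pow_eq hC hz _ _ _ (by omega) (by omega) rfl x y hN hM

end NearDedekind

/-! ### 2-groups with all cyclic subgroups normal -/

/-- Descent on the orders `2 ^ (N + 1)`, `2 ^ (M + 1)` of a noncommuting pair. If `a ^ 2` commutes
with `b`, the commutator is the involution of both `⟨a⟩` and `⟨b⟩`; unless both orders are 4, some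
`a ^ i * b` has smaller order than `b` and still does not commute with `a`. -/
theorem exists_quaternion_pair (hC : IsPGroup 2 C)
    (hD : ∀ x y : C, ∃ k : ℤ, y * x * y⁻¹ = x ^ k) (s : ℕ) :
    ∀ (N M : ℕ) (a b : C), N + M = s → ¬ Commute a b → a ^ 2 ^ N ≠ 1 → (a ^ 2 ^ N) ^ 2 = 1 →
      b ^ 2 ^ M ≠ 1 → (b ^ 2 ^ M) ^ 2 = 1 →
      ∃ a b : C, ¬ Commute a b ∧ a ^ 2 = b ^ 2 ∧ a ^ 4 = 1 := by
  have hinv : ∀ u : C, u ^ 2 = 1 → ∀ y, Commute u y := fun u hu y =>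
    commute_of_conj_mem_zpowers_of_sq_eq_one (hD u) hu y
  induction s using Nat.strong_induction_on with
  | _ s ih =>
    intro N M a b hs hab ha1 ha2 hb1 hb2
    wlog hMN : M ≤ N generalizing N M a b
    · exact this M N b a (by omega) (fun h => hab h.symm) hb1 hb2 ha1 ha2 (by omega)
    subst hs
    have hM : M ≠ 0 := by
      rintro rfl
      exact hab (hinv b (by simpa using hb2) a).symm
    by_cases hca : Commute (a ^ 2) b
    swap
    · have h : (a ^ 2) ^ 2 ^ (N - 1) = a ^ 2 ^ N := by
        rw [← pow_mul, ← pow_succ', Nat.sub_add_cancel (by omega)]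
      exact ih _ (by omega) (N - 1) M (a ^ 2) b rfl hca (by rwa [h]) (by rwa [h]) hb1 hb2
    obtain ⟨k, hk⟩ := hD a b
    obtain ⟨l, hl⟩ := hD b a
    obtain ⟨v, hv⟩ : ∃ v, v = a ^ (k - 1) := ⟨_, rfl⟩
    have hva : Commute v a := by rw [hv]; exact (Commute.refl a).zpow_left _
    have hbav : b * a * b⁻¹ = a * v := by rw [hk, hv, ← zpow_one_add]; congr 1; ring
    have hv1 : v ≠ 1 := fun h => by
      rw [h, mul_one] at hbav
      exact hab (mul_inv_eq_iff_eq_mul.1 hbav).symm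
    have hv2 : v ^ 2 = 1 := by
      have h1 : (b * a * b⁻¹) ^ 2 = a ^ 2 := by
        rw [conj_pow]; exact mul_inv_eq_iff_eq_mul.2 hca.eq.symm
      rw [hbav, hva.symm.mul_pow] at h1
      simpa using h1
    have hvc := hinv v hv2
    have hba : b * a = a * b * v := by
      rw [mul_inv_eq_iff_eq_mul.1 hbav, mul_assoc, mul_assoc, (hvc b).eq]
    have hab' : a * b = b * a * v := by rw [hba, mul_assoc, ← sq, hv2, mul_one]
    have hva' : v = a ^ 2 ^ N := involution_eq_of_mem_zpowers rfl ha1 ha2 hv.symm hv1 hv2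
    have hvb : b ^ (l - 1) = v := by
      rw [sub_eq_neg_add, zpow_add, ← hl, hab', mul_assoc, mul_assoc, (hvc a⁻¹).eq]
      simp
    have hvb' : v = b ^ 2 ^ M := involution_eq_of_mem_zpowers rfl hb1 hb2 hvb hv1 hv2
    by_cases hN : N = 1
    · obtain rfl : M = 1 := by omega
      subst hN
      refine ⟨a, b, hab, by simpa using hva'.symm.trans hvb', ?_⟩
      rw [show (4 : ℕ) = 2 ^ 1 * 2 from rfl, pow_mul, ← hva', hv2]
    set i := 2 ^ (N - M) with hi
    have hp := mul_pow_two_pow (k := M) (pow_mul_eq_of_mul_eq hab' (hvc a) i)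
      ((hvc _).pow_left i) ((hvc _).pow_left i)
      (by rw [← pow_mul, mul_comm, pow_mul, hv2, one_pow]) (by
        by_cases hM1 : M = 1
        · right
          rw [hi, hM1, show N - 1 = 1 + (N - 2) by omega, pow_add, pow_mul, pow_one, hv2, one_pow]
        · left; omega)
    have hq : (a ^ i * b) ^ 2 ^ M = 1 := by
      rw [hp, ← hvb', hi, ← pow_mul, ← pow_add, Nat.sub_add_cancel hMN, ← hva', ← sq, hv2]
    have hnc : ¬ Commute a (a ^ i * b) := fun h => hab (commute_of_commute_pow_mul i h)
    obtain ⟨j, hj1, hj2⟩ := exists_pow_two_pow_involution hC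
      (fun h => hnc (h ▸ Commute.one_right a) : a ^ i * b ≠ 1)
    refine ih _ ?_ N j a (a ^ i * b) rfl hnc ha1 ha2 hj1 hj2
    have : j < M := by
      by_contra hjM
      apply hj1
      rw [← Nat.sub_add_cancel (not_lt.1 hjM), add_comm, pow_add, pow_mul, hq, one_pow]
    omega

/-- A `2`-group with all cyclic subgroups normal is abelian, or it is generated by a quaternion
subgroup `⟨a, b⟩` and its center. -/
theorem exists_pair_forall_mul_central (hC : IsPGroup 2 C)
    (hD : ∀ x y : C, ∃ k : ℤ, y * x * y⁻¹ = x ^ k) :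
    ∃ a b : C, ∀ c : C, ∃ i j : Fin 2, ∀ y, Commute (c * (a ^ (i : ℕ) * b ^ (j : ℕ))) y := by
  by_cases hab : ∀ x y : C, Commute x y
  · exact ⟨1, 1, fun c => ⟨0, 0, fun y => hab _ _⟩⟩
  push Not at hab
  obtain ⟨a, b, hab⟩ := hab
  have ha1 : a ≠ 1 := fun h => hab (h ▸ Commute.one_left b)
  have hb1 : b ≠ 1 := fun h => hab (h ▸ Commute.one_right a)
  obtain ⟨N, hN1, hN2⟩ := exists_pow_two_pow_involution hC ha1
  obtain ⟨M, hM1, hM2⟩ := exists_pow_two_pow_involution hC hb1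
  obtain ⟨a, b, hab, hsq, ha4⟩ := exists_quaternion_pair hC hD _ N M a b rfl hab hN1 hN2 hM1 hM2
  have hinv : ∀ u : C, u ^ 2 = 1 → ∀ y, Commute u y := fun u hu y =>
    commute_of_conj_mem_zpowers_of_sq_eq_one (hD u) hu y
  obtain ⟨v, hv⟩ : ∃ v, v = a ^ 2 := ⟨_, rfl⟩
  have hv2 : v ^ 2 = 1 := by rw [hv, ← pow_mul, ha4]
  have hv1 : v ≠ 1 := fun h => hab (hinv a (hv.symm.trans h) b)
  have hvc := hinv v hv2
  have conj (x : C) (hx : x ^ 2 = v) (y : C) : y * x = x * y ∨ y * x = x * y * v := by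
    obtain ⟨k, hk⟩ := hD x y
    have hyx := mul_inv_eq_iff_eq_mul.1 hk
    have hw2 : (x ^ (k - 1)) ^ 2 = 1 := by
      have h1 : (y * x * y⁻¹) ^ 2 = x ^ 2 := by
        rw [conj_pow, hx]; exact mul_inv_eq_iff_eq_mul.2 (hvc y).eq.symm
      rw [hk] at h1
      rw [← zpow_natCast, ← zpow_mul, sub_mul, zpow_sub, zpow_mul, zpow_natCast, h1]
      norm_cast
      simp
    have hk' : x ^ k = x * x ^ (k - 1) := by rw [← zpow_one_add]; congr 1; ring
    by_cases hw1 : x ^ (k - 1) = 1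
    · left; rw [hyx, hk', hw1, mul_one]
    · right
      have := involution_eq_of_mem_zpowers (k := 1) (by simpa using hx) hv1 hv2 rfl hw1 hw2
      rw [hyx, hk', this, mul_assoc, (hvc y).eq, mul_assoc]
  have hb2 : b ^ 2 = v := by rw [hv, hsq]
  have hba : b * a = a * b * v := (conj a hv.symm b).resolve_left fun h => hab h.symm
  have hab' : a * b = b * a * v := by rw [hba, mul_assoc, ← sq, hv2, mul_one]
  -- It suffices that `d ^ 2 = 1`. Otherwise a power `d0` of `d` has order 4, and normality of `⟨d0
  -- * a⟩` puts `v` there beside the involution `d0 ^ 2 * v`, forcing `d0 ^ 2 = 1`.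
  have central (d : C) (hda : Commute d a) (hdb : Commute d b) (y : C) : Commute d y := by
    apply hinv
    by_contra hd2
    obtain ⟨M, h1, h2⟩ := exists_pow_two_pow_involution hC hd2
    set d0 := (d ^ 2 ^ M) with hd0
    have hu : d0 ^ 2 = (d ^ 2) ^ 2 ^ M := by rw [hd0, ← pow_mul, ← pow_mul, mul_comm]
    rw [← hu] at h1 h2
    have hda0 : Commute d0 a := hda.pow_left _
    have hdb0 : Commute d0 b := hdb.pow_left _
    have hsq : (d0 * a) ^ 2 = d0 ^ 2 * v := by rw [hda0.mul_pow, hv]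
    have hconj : b * (d0 * a) * b⁻¹ = d0 * a * v := by
      rw [← mul_assoc, ← hdb0.eq, mul_assoc d0, hba, mul_assoc (a := d0), mul_assoc (a := a * b),
        (hvc b⁻¹).eq]
      group
    obtain ⟨k, hk⟩ := hD (d0 * a) b
    have hvk : (d0 * a) ^ (k - 1) = v := by
      rw [sub_eq_neg_add, zpow_add, ← hk, hconj, zpow_neg_one, inv_mul_cancel_left]
    have huv : d0 ^ 2 * v ≠ 1 := by
      intro h
      have h3 := hinv _ (hsq.trans h) b
      have h4 := mul_inv_eq_iff_eq_mul.2 h3.eq.symm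
      rw [hconj] at h4
      exact hv1 (by simpa using h4)
    have huv2 : (d0 ^ 2 * v) ^ 2 = 1 := by
      rw [(hvc _).symm.mul_pow, h2, hv2, one_mul]
    have := involution_eq_of_mem_zpowers (k := 1) (by simpa using hsq) huv huv2 hvk hv1 hv2
    exact h1 (by simpa using this.symm)
  refine ⟨a, b, fun c => ?_⟩
  have adj (c x y : C) (hc : c * x = x * c * v) (hy : y * x = x * y * v) : Commute (c * y) x := by
    calc c * y * x = c * x * (y * v) := by rw [mul_assoc, hy]; simp only [mul_assoc]
      _ = x * c * (v ^ 2) * y := by rw [hc, ← (hvc y).eq, sq]; simp only [mul_assoc]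
      _ = x * (c * y) := by rw [hv2, mul_one, mul_assoc]
  obtain ⟨j, hj⟩ : ∃ j : Fin 2, Commute (c * b ^ (j : ℕ)) a := by
    rcases conj a hv.symm c with h | h
    · exact ⟨0, by simpa [Commute, SemiconjBy] using h⟩
    · exact ⟨1, by simpa using adj c a b h hba⟩
  obtain ⟨i, hi⟩ : ∃ i : Fin 2, Commute (c * b ^ (j : ℕ) * a ^ (i : ℕ)) b := by
    rcases conj b hb2 (c * b ^ (j : ℕ)) with h | h
    · exact ⟨0, by simpa [Commute, SemiconjBy] using h⟩
    · exact ⟨1, by simpa using adj _ b a h hab'⟩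
  have hw : ∃ w : C, (∀ y, Commute w y) ∧ a ^ (i : ℕ) * b ^ (j : ℕ) =
      b ^ (j : ℕ) * a ^ (i : ℕ) * w := by
    fin_cases i <;> fin_cases j <;>
      first
      | exact ⟨v, hvc, by simpa using hab'⟩
      | exact ⟨1, fun y => Commute.one_left y, by simp⟩
  obtain ⟨w, hwc, hw⟩ := hw
  refine ⟨i, j, fun y => ?_⟩
  rw [hw, ← mul_assoc, ← mul_assoc]
  exact (central _ (hj.mul_left ((Commute.refl a).pow_left _)) hi y).mul_left (hwc y)

end TwoGroup

/-! ### From breadth one to the centralizer of a dihedral subgroup -/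

section Breadth

variable {G : Type*} [Group G]

theorem mem_normalizer_or_of_groupSbr_eq_one [Finite G] (hG : IsPGroup 2 G)
    (hbr : groupSbr 2 G = 1) (H : Subgroup G) (a b : G) :
    a ∈ Subgroup.normalizer (H : Set G) ∨ b ∈ Subgroup.normalizer (H : Set G) ∨
      a * b ∈ Subgroup.normalizer (H : Set G) := by
  have hle : sbr 2 H ≤ 1 := hbr ▸ (isGreatest_groupSbr 2 G).2 ⟨H, rfl⟩
  have hidx := index_normalizer_eq_pow_sbr hG H
  rcases Nat.le_one_iff_eq_zero_or_eq_one.1 hle with h | h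
  · rw [h, pow_zero, Subgroup.index_eq_one] at hidx
    left; rw [hidx]; trivial
  · rw [h, pow_one] at hidx
    rw [Subgroup.mul_mem_iff_of_index_two hidx]
    tauto

/-- Normalizers of subgroups have index at most two. -/
def NormalizersIndexLeTwo (G : Type*) [Group G] : Prop :=
  ∀ (H : Subgroup G) (a b : G), a ∈ Subgroup.normalizer (H : Set G) ∨
    b ∈ Subgroup.normalizer (H : Set G) ∨ a * b ∈ Subgroup.normalizer (H : Set G)

theorem conj_mem_of_mem_normalizer {H : Subgroup G} {g h : G}
    (hg : g ∈ Subgroup.normalizer (H : Set G)) (hh : h ∈ H) : g * h * g⁻¹ ∈ H :=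
  (Subgroup.mem_normalizer_iff.1 hg h).1 hh

theorem commute_of_mem_normalizer_zpowers {u g : G} (hu : u ^ 2 = 1)
    (hg : g ∈ Subgroup.normalizer (Subgroup.zpowers u : Set G)) : Commute g u := by
  obtain ⟨k, hk⟩ := conj_mem_of_mem_normalizer hg (Subgroup.mem_zpowers u)
  have hk : u ^ k = g * u * g⁻¹ := hk
  rcases zpow_eq_one_or_self hu k with h | h
  · rw [h] at hk
    have : u = 1 := by simpa using hk.symm
    rw [this]; exact Commute.one_right g
  · rw [h] at hk
    exact mul_inv_eq_iff_eq_mul.1 hk.symm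

theorem NormalizersIndexLeTwo.commute_or (hB : NormalizersIndexLeTwo G) {u : G} (hu : u ^ 2 = 1)
    (a b : G) : Commute a u ∨ Commute b u ∨ Commute (a * b) u :=
  (hB (Subgroup.zpowers u) a b).imp (commute_of_mem_normalizer_zpowers hu)
    (Or.imp (commute_of_mem_normalizer_zpowers hu) (commute_of_mem_normalizer_zpowers hu))

/-- The subgroup generated by two commuting elements. -/
def commutingSpan (s x : G) (h : Commute s x) : Subgroup G where
  carrier := {y | ∃ i j : ℤ, y = s ^ i * x ^ j}
  one_mem' := ⟨0, 0, by simp⟩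
  mul_mem' := by
    rintro _ _ ⟨i, j, rfl⟩ ⟨k, l, rfl⟩
    refine ⟨i + k, j + l, ?_⟩
    rw [zpow_add, zpow_add, mul_assoc, mul_assoc, ← mul_assoc (x ^ j),
      ← (h.zpow_zpow k j).eq]
    simp only [mul_assoc]
  inv_mem' := by
    rintro _ ⟨i, j, rfl⟩
    refine ⟨-i, -j, ?_⟩
    rw [mul_inv_rev, zpow_neg, zpow_neg, ((h.zpow_zpow i j).inv_inv).eq]

/-- Neither `t` nor `s * t` centralizes `s`, so their product `t * s * t` does; this gives `(s * t)
^ 4 = 1`. -/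
theorem NormalizersIndexLeTwo.exists_dihedral_center (hB : NormalizersIndexLeTwo G) {s t : G}
    (hs : s ^ 2 = 1) (ht : t ^ 2 = 1) (hst : ¬ Commute s t) :
    ∃ z : G, z ≠ 1 ∧ z ^ 2 = 1 ∧ Commute z s ∧ Commute z t ∧ (s * t) ^ 2 = z ∧
      t * s = s * t * z := by
  have hs' : s * s = 1 := by rw [← sq, hs]
  have ht' : t * t = 1 := by rw [← sq, ht]
  have hc : Commute (t * (s * t)) s := by
    rcases hB.commute_or hs t (s * t) with h | h | h
    · exact absurd h.symm hst
    · refine absurd ?_ hst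
      have h1 : s * (t * s) = s * (s * t) := by rw [← mul_assoc]; exact h.eq
      exact (mul_left_cancel h1).symm
    · exact h
  have hc' : t * (s * (t * s)) = s * (t * (s * t)) := by simpa only [mul_assoc] using hc.eq
  have hss (y : G) : s * (s * y) = y := by rw [← mul_assoc, hs', one_mul]
  have htt (y : G) : t * (t * y) = y := by rw [← mul_assoc, ht', one_mul]
  refine ⟨s * (t * (s * t)), ?_, ?_, ?_, ?_, ?_, ?_⟩
  · intro h
    apply hst
    have h1 : t * (s * t) = s := by rw [← hss (t * (s * t)), h, mul_one]
    have h2 : s * t = t * s := by rw [← htt (s * t), h1]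
    exact h2
  · rw [sq]
    nth_rewrite 2 [← hc']
    simp only [mul_assoc, hss, htt, hs']
  · show s * (t * (s * t)) * s = s * (s * (t * (s * t)))
    simp only [mul_assoc, hc']
  · show s * (t * (s * t)) * t = t * (s * (t * (s * t)))
    rw [← hc']
    simp only [mul_assoc, hc', ht', mul_one]
    rw [← hc']; simp only [htt]
  · simp only [sq, mul_assoc]
  · rw [← hc']; simp only [mul_assoc, htt, hss]

theorem NormalizersIndexLeTwo.exists_mul_commute (hB : NormalizersIndexLeTwo G) {s t : G}
    (hs : s ^ 2 = 1) (ht : t ^ 2 = 1) (hst : ¬ Commute s t) (g : G) :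
    ∃ i j : Fin 2, Commute (g * t ^ (j : ℕ) * s ^ (i : ℕ)) s ∧
      Commute (g * t ^ (j : ℕ) * s ^ (i : ℕ)) t := by
  obtain ⟨j, hj⟩ : ∃ j : Fin 2, Commute (g * t ^ (j : ℕ)) s := by
    rcases hB.commute_or hs g t with h | h | h
    · exact ⟨0, by simpa using h⟩
    · exact absurd h.symm hst
    · exact ⟨1, by simpa using h⟩
  obtain ⟨i, hi⟩ : ∃ i : Fin 2, Commute (g * t ^ (j : ℕ) * s ^ (i : ℕ)) t := by
    rcases hB.commute_or ht (g * t ^ (j : ℕ)) s with h | h | h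
    · exact ⟨0, by simpa using h⟩
    · exact absurd h hst
    · exact ⟨1, by simpa using h⟩
  exact ⟨i, j, hj.mul_left ((Commute.refl s).pow_left _), hi⟩

/-- Both `t` and `t * g` send `s` to `s * z`, outside `K = ⟨s, x⟩`. So `g` normalizes `K`, and also
the part of `K` centralized by `t`, which is `⟨x⟩`. -/
theorem NormalizersIndexLeTwo.conj_of_avoid (hB : NormalizersIndexLeTwo G) {s t z : G}
    (hs : s ^ 2 = 1) (hst : ¬ Commute s t) (hzt : Commute z t)
    (hts : t * s = s * t * z) {x g : G} (hxs : Commute x s) (hxt : Commute x t)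
    (hx : ∀ k : ℤ, x ^ k ≠ z) (hgs : Commute g s) (hgt : Commute g t) :
    ∃ k : ℤ, g * x * g⁻¹ = x ^ k := by
  set K := commutingSpan s x hxs.symm
  have mem (y : G) (hyt : Commute y t) (hy : y ∈ K) : ∃ k : ℤ, y = x ^ k := by
    obtain ⟨i, j, rfl⟩ := hy
    rcases zpow_eq_one_or_self hs i with h | h
    · exact ⟨j, by rw [h, one_mul]⟩
    · refine absurd ?_ hst
      rw [h] at hyt
      have := hyt.mul_left (hxt.zpow_left j).inv_left
      rwa [mul_inv_cancel_right] at this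
  have hsK : s ∈ K := ⟨1, 0, by simp⟩
  have hxK : x ∈ K := ⟨0, 1, by simp⟩
  have htst : t * s * t⁻¹ = s * z := by
    rw [hts, mul_assoc, mul_assoc, hzt.inv_right.eq, mul_inv_cancel_left]
  have hzK : s * z ∉ K := fun h => by
    obtain ⟨k, hk⟩ := mem z hzt ((Subgroup.mul_mem_cancel_left K hsK).1 h)
    exact hx k hk.symm
  rcases hB K t g with h | h | h
  · exact absurd (htst ▸ conj_mem_of_mem_normalizer h hsK) hzK
  · exact mem _ ((hgt.mul_left hxt).mul_left hgt.inv_left) (conj_mem_of_mem_normalizer h hxK)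
  · have h1 : t * g * s * (t * g)⁻¹ = t * s * t⁻¹ := by
      rw [mul_assoc t, hgs.eq]; group
    exact absurd (htst ▸ h1 ▸ conj_mem_of_mem_normalizer h hsK) hzK

/-- The element `s * t * x` squares to 1 and is not centralized by `s`, so `g` or `s * g`
centralizes it; these are the two alternatives. -/
theorem NormalizersIndexLeTwo.conj_of_sq_eq (hB : NormalizersIndexLeTwo G) {s t z : G}
    (hst : ¬ Commute s t) (hz : z ^ 2 = 1)
    (hsq : (s * t) ^ 2 = z) (hts : t * s = s * t * z) {x g : G} (hxs : Commute x s)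
    (hxt : Commute x t) (hx : x ^ 2 = z) (hgs : Commute g s) (hgt : Commute g t) :
    g * x * g⁻¹ = x ∨ g * x * g⁻¹ = x * z := by
  have hxst : Commute x (s * t) := hxs.mul_right hxt
  have hgst : Commute g (s * t) := hgs.mul_right hgt
  have hzx : Commute z x := hx ▸ (Commute.refl x).pow_left 2
  have hu : (s * t * x) ^ 2 = 1 := by rw [hxst.symm.mul_pow, hsq, hx, ← sq, hz]
  rcases hB.commute_or hu s g with h | h | h
  · refine absurd ?_ hst
    have h1 := h.mul_right hxs.symm.inv_right
    rw [mul_inv_cancel_right] at h1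
    have h2 : s * (s * t) = s * (t * s) := by rw [h1.eq, mul_assoc]
    exact mul_left_cancel h2
  · left
    have h1 := hgst.inv_right.mul_right h
    rw [inv_mul_cancel_left] at h1
    exact mul_inv_eq_iff_eq_mul.2 h1.eq
  · right
    have h1 : s * (s * t * (g * x)) = s * (s * t * (z * x * g)) := by
      calc s * (s * t * (g * x)) = s * g * (s * t * x) := by
            rw [← mul_assoc (s * t), ← hgst.eq]; simp only [mul_assoc]
        _ = s * t * (x * s) * g := by rw [h.eq]; simp only [mul_assoc]
        _ = s * (t * s) * x * g := by rw [hxs.eq]; simp only [mul_assoc]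
        _ = s * (s * t * (z * x * g)) := by rw [hts]; simp only [mul_assoc]
    have h2 := mul_left_cancel (mul_left_cancel h1)
    rw [mul_inv_eq_iff_eq_mul, h2, hzx.eq]

theorem NormalizersIndexLeTwo.conj_sq (hB : NormalizersIndexLeTwo G) (x g : G) :
    ∃ k : ℤ, g ^ 2 * x * (g ^ 2)⁻¹ = x ^ k := by
  have hg : g ^ 2 ∈ Subgroup.normalizer (Subgroup.zpowers x : Set G) := by
    rcases hB (Subgroup.zpowers x) g g with h | h | h
    · exact pow_mem h 2
    · exact pow_mem h 2
    · rwa [sq]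
  obtain ⟨k, hk⟩ := conj_mem_of_mem_normalizer hg (Subgroup.mem_zpowers x)
  exact ⟨k, hk.symm⟩

theorem mem_centralizer_pair_iff {s t c : G} :
    c ∈ Subgroup.centralizer ({s, t} : Set G) ↔ Commute c s ∧ Commute c t := by
  simp [Subgroup.mem_centralizer_iff, Commute, SemiconjBy, eq_comm (a := c * _)]

theorem NormalizersIndexLeTwo.nearDedekind_centralizer (hB : NormalizersIndexLeTwo G) {s t z : G}
    (hs : s ^ 2 = 1) (hst : ¬ Commute s t) (hz1 : z ≠ 1) (hz : z ^ 2 = 1)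
    (hzs : Commute z s) (hzt : Commute z t) (hsq : (s * t) ^ 2 = z) (hts : t * s = s * t * z) :
    NearDedekind (⟨z, mem_centralizer_pair_iff.2 ⟨hzs, hzt⟩⟩ :
      Subgroup.centralizer ({s, t} : Set G)) where
  ne_one h := hz1 (congrArg Subtype.val h)
  sq_eq_one := Subtype.ext hz
  central y := by
    obtain ⟨h1, h2⟩ := mem_centralizer_pair_iff.1 y.2
    have h : Commute (y : G) z := hsq ▸ (h1.mul_right h2).pow_right 2
    exact Subtype.ext h.symm.eq
  conj_of_avoid x hx y := by
    obtain ⟨h1, h2⟩ := mem_centralizer_pair_iff.1 x.2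
    obtain ⟨h3, h4⟩ := mem_centralizer_pair_iff.1 y.2
    obtain ⟨k, hk⟩ := hB.conj_of_avoid hs hst hzt hts h1 h2
      (fun k hk => hx k (Subtype.ext (by simpa using hk))) h3 h4
    exact ⟨k, Subtype.ext (by simpa using hk)⟩
  conj_of_sq_eq x hx y := by
    obtain ⟨h1, h2⟩ := mem_centralizer_pair_iff.1 x.2
    obtain ⟨h3, h4⟩ := mem_centralizer_pair_iff.1 y.2
    exact (hB.conj_of_sq_eq hst hz hsq hts h1 h2 (congrArg Subtype.val hx) h3 h4).imp
      (fun h => Subtype.ext h) (fun h => Subtype.ext h)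
  conj_sq x y := by
    obtain ⟨k, hk⟩ := hB.conj_sq (x : G) y
    exact ⟨k, Subtype.ext (by simpa using hk)⟩

theorem index_center_le_of_exists_mul_mem_center {ι : Type*} [Finite ι] (f : ι → G)
    (hf : ∀ g, ∃ i, g * f i ∈ Subgroup.center G) : (Subgroup.center G).index ≤ Nat.card ι := by
  apply Nat.card_le_card_of_surjective (fun i => ((f i)⁻¹ : G ⧸ Subgroup.center G))
  intro q
  obtain ⟨g, rfl⟩ := QuotientGroup.mk_surjective q
  obtain ⟨i, hi⟩ := hf g
  refine ⟨i, ?_⟩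
  symm
  apply eq_inv_of_mul_eq_one_left
  rw [← QuotientGroup.mk_mul]
  exact (QuotientGroup.eq_one_iff _).2 hi

end Breadth

theorem mainTheorem6 {G : Type*} [Group G] [Finite G] (hG : IsPGroup 2 G)
    (hbr : groupSbr 2 G = 1)
    (hst : ∃ s t : G, orderOf s = 2 ∧ orderOf t = 2 ∧ s * t ≠ t * s) :
    (Subgroup.center G).index ≤ 16 := by
  have hB : NormalizersIndexLeTwo G := mem_normalizer_or_of_groupSbr_eq_one hG hbr
  obtain ⟨s, t, hs, ht, hst⟩ := hst
  have hs : s ^ 2 = 1 := hs ▸ pow_orderOf_eq_one s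
  have ht : t ^ 2 = 1 := ht ▸ pow_orderOf_eq_one t
  obtain ⟨z, hz1, hz, hzs, hzt, hsq, hts⟩ := hB.exists_dihedral_center hs ht hst
  have hC := hG.to_subgroup (Subgroup.centralizer ({s, t} : Set G))
  obtain ⟨a, b, hab⟩ := exists_pair_forall_mul_central hC
    ((hB.nearDedekind_centralizer hs hst hz1 hz hzs hzt hsq hts).conj_mem_zpowers hC)
  -- Two binary exponents move `g` into the centralizer of `{s, t}` and two more into its center: 16
  -- representatives.
  have key := index_center_le_of_exists_mul_mem_center
    (fun i : (Fin 2 × Fin 2) × (Fin 2 × Fin 2) =>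
      t ^ (i.1.2 : ℕ) * s ^ (i.1.1 : ℕ) * ((a : G) ^ (i.2.1 : ℕ) * (b : G) ^ (i.2.2 : ℕ)))
    (fun g => by
      obtain ⟨i, j, h1, h2⟩ := hB.exists_mul_commute hs ht hst g
      obtain ⟨k, l, hc⟩ := hab ⟨_, mem_centralizer_pair_iff.2 ⟨h1, h2⟩⟩
      refine ⟨((i, j), (k, l)), ?_⟩
      obtain ⟨c, hcdef⟩ : ∃ c : Subgroup.centralizer ({s, t} : Set G), c =
        ⟨_, mem_centralizer_pair_iff.2 ⟨h1, h2⟩⟩ * (a ^ (k : ℕ) * b ^ (l : ℕ)) := ⟨_, rfl⟩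
      rw [← hcdef] at hc
      have hcG : g * (t ^ (j : ℕ) * s ^ (i : ℕ) * ((a : G) ^ (k : ℕ) * (b : G) ^ (l : ℕ))) = c := by
        rw [hcdef]; simp [mul_assoc]
      obtain ⟨hcs, hct⟩ := mem_centralizer_pair_iff.1 c.2
      show g * (t ^ (j : ℕ) * s ^ (i : ℕ) * ((a : G) ^ (k : ℕ) * (b : G) ^ (l : ℕ))) ∈ _
      rw [hcG, Subgroup.mem_center_iff]
      intro y
      -- `c` commutes with `s`, `t` and their centralizer, which together generate `G`.
      obtain ⟨i', j', h3, h4⟩ := hB.exists_mul_commute hs ht hst y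
      have h5 : Commute (c : G) (y * t ^ (j' : ℕ) * s ^ (i' : ℕ)) :=
        congrArg Subtype.val (hc ⟨_, mem_centralizer_pair_iff.2 ⟨h3, h4⟩⟩).eq
      have h6 := (h5.mul_right (hcs.pow_right i').inv_right).mul_right
        (hct.pow_right j').inv_right
      rw [mul_inv_cancel_right, mul_inv_cancel_right] at h6
      exact h6.eq.symm)
  simpa using key
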